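/- Let $D$ be a finite set. A weighted relation on $D$ is a map $\phi:D^m\to\mathbb{Q}\cup\{\infty\}$ with $m\ge 1$, and a valued constraint language on $D$ is any (possibly infinite) set $\Gamma$ of weighted relations on $D$. An instance $I$ of $\mathrm{VCSP}(\Gamma)$ consists of variables $x_1,\dots,x_n$ and an objective function $I(x_1,\dots,x_n)=\sum_{i=1}^{q}\phi_i(\mathbf{x}_i)$, where $\phi_i\in\Gamma$ and $\mathbf{x}_i$ is a tuple of variables; the goal is to find an assignment of labels from $D$ to the variables that minimises $I$. The language $\Gamma$ is tractable if for every finite $\Gamma_0\subseteq\Gamma$ a minimising assignment of instances of $\mathrm{VCSP}(\Gamma_0)$ can be found in polynomial time, and intractable if $\mathrm{VCSP}(\Gamma_0)$ is NP-hard for some finite $\Gamma_0\subseteq\Gamma$ (that is, deciding, for an instance $I$ and $q\in\mathbb{Q}$, whether some assignment has cost at most $q$ is NP-hard under polynomial-time many-one reductions). Write $\phi(\mathbf{x})<\infty$ as $\mathbf{x}\in\mathrm{Feas}(\phi)$. Let $\mathrm{Pol}^{(1)}(\Gamma)$ be the set of maps $f:D\to D$ such that, for all $\phi\in\Gamma$,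 $\mathbf{x}\in\mathrm{Feas}(\phi)$ implies $f(\mathbf{x})\in\mathrm{Feas}(\phi)$, where $f$ acts coordinatewise. A unary weighted polymorphism of $\Gamma$ is a function $\omega:\mathrm{Pol}^{(1)}(\Gamma)\to\mathbb{Q}$ such that $\sum_f\omega(f)=0$, $\omega(f)<0$ only if $f$ is the identity, and $\sum_f\omega(f)\,\phi(f(\mathbf{x}))\le 0$ for all $\phi\in\Gamma$ and $\mathbf{x}\in\mathrm{Feas}(\phi)$. The language $\Gamma$ is a core if for every unary weighted polymorphism $\omega$ of $\Gamma$, every $f$ with $\omega(f)>0$ is bijective. **Theorem.** Let $\Gamma$ be a valued constraint language on $D$ that is not a core. Then there are a non-empty subset $D'\subseteq D$ and a valued constraint language $\Gamma'$ on $D'$ such that $\Gamma'$ is a core, $\Gamma$ is tractable if and only if $\Gamma'$ is tractable, and $\Gamma$ is intractable if and only if $\Gamma'$ is intractable. -/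

import Mathlib

namespace VCSP

universe u

/-! ### Weighted relations, instances, objective functions -/

/-- A weighted relation over `D` (with its arity), with values in `ℚ ∪ {∞}`. -/
abbrev WRel (D : Type u) := Σ m : ℕ, (Fin m → D) → WithTop ℚ

/-- The underlying feasibility relation. -/
def WRel.feas {D : Type u} (φ : WRel D) : Set (Fin φ.1 → D) :=
  {x | φ.2 x < ⊤}

/-- A valued constraint language over `D`: any set of weighted relations. -/
abbrev Lang (D : Type u) := ValuedCSP D (WithTop ℚ)

/-- All weighted relations of `Γ` have arity at least one. -/
def PositiveArity {D : Type u} (Γ : Lang D) : Prop :=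
  ∀ φ ∈ Γ, 0 < φ.1

/-- An instance of `VCSP(Γ)` as it is given to an algorithm: finitely many variables and a list of
valued constraints, which may appear several times. -/
structure Inst {D : Type u} (Γ : Lang D) where
  nvars : ℕ
  constraints : List (ValuedCSP.Term Γ (Fin nvars))

/-- The underlying Mathlib instance, in which the constraints are unordered. -/
def Inst.toInstance {D : Type u} {Γ : Lang D} (I : Inst Γ) :
    ValuedCSP.Instance Γ (Fin I.nvars) :=
  (I.constraints : Multiset (ValuedCSP.Term Γ (Fin I.nvars)))

/-- The objective function: the sum of the costs of all constraints. -/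
def Inst.objective {D : Type u} {Γ : Lang D} (I : Inst Γ) (s : Fin I.nvars → D) : WithTop ℚ :=
  I.toInstance.evalSolution s

/-- `s` is an assignment of minimal cost. -/
def Inst.IsOptimal {D : Type u} {Γ : Lang D} (I : Inst Γ) (s : Fin I.nvars → D) : Prop :=
  I.toInstance.IsOptimumSolution s

/-! ### Encoding of instances as strings

The problem is only considered for a finite language, so each weighted relation is one letter of the
(finite) input alphabet. Variables are listed explicitly, so that the length of the input is at
least the number of variables; their indices and the numerator and denominator of a threshold are
written in binary. -/

/-- The input alphabet; `R` is the finite set of available weighted relations. -/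
inductive Letter (R : Type u) : Type u
  | var
  | rel (r : R)
  | comma
  | bit (b : Bool)
  | threshold

/-- A natural number in binary. -/
def encodeNat {R : Type u} (n : ℕ) : List (Letter R) :=
  (Computability.encodeNat n).map Letter.bit

/-- A rational number: sign, binary numerator, comma, binary denominator. -/
def encodeRat {R : Type u} (q : ℚ) : List (Letter R) :=
  Letter.bit (decide (q < 0)) :: encodeNat q.num.natAbs ++ Letter.comma :: encodeNat q.den

/-- A constraint: the weighted relation, then the indices of the variables in its scope. -/
def encodeTerm {D : Type u} {Γ : Lang D} {n : ℕ} (t : ValuedCSP.Term Γ (Fin n)) :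
    List (Letter Γ) :=
  Letter.rel ⟨⟨t.n, t.f⟩, t.inΓ⟩ ::
    (List.ofFn fun i => Letter.comma :: encodeNat (t.app i : ℕ)).flatten

/-- An instance: the list of its variables, then its constraints. -/
def Inst.encode {D : Type u} {Γ : Lang D} (I : Inst Γ) : List (Letter Γ) :=
  List.replicate I.nvars Letter.var ++ I.constraints.flatMap encodeTerm

/-- An instance together with a rational threshold. -/
def encodeWithThreshold {D : Type u} {Γ : Lang D} (p : Inst Γ × ℚ) : List (Letter Γ) :=
  p.1.encode ++ Letter.threshold :: encodeRat p.2

/-! ### Polynomial time, NP, and NP-hardness -/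

/-- Some (multi-stack) Turing machine, started on the string `enc a`, halts within a number of
steps that is polynomial in the length of `enc a`, with an output string `w` such that `Out a w`.
The letters of `A` are written as symbols of the machine by `inp`, and the symbols on its output
stack are read as letters of `B` by `out`. -/
def ComputesInPolyTime {α : Type*} {A : Type*} {B : Type*} (enc : α → List A)
    (Out : α → List B → Prop) : Prop :=
  ∃ (tm : Turing.FinTM2) (inp : A → tm.Γ tm.k₀) (out : tm.Γ tm.k₁ → B) (time : Polynomial ℕ),
    ∀ a : α, ∃ w : List (tm.Γ tm.k₁),
      Nonempty (Turing.TM2OutputsInTime tm ((enc a).map inp) (some w)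
        (time.eval (enc a).length)) ∧
      Out a (w.map out)

/-- A pair of binary strings as one string over two disjoint copies of the binary alphabet. -/
def encodePair (p : List Bool × List Bool) : List (Bool ⊕ Bool) :=
  p.1.map Sum.inl ++ p.2.map Sum.inr

/-- The complexity class NP, for languages of binary strings: there is a polynomial-time verifier
for certificates of polynomial length. -/
def InNP (L : Set (List Bool)) : Prop :=
  ∃ (V : List Bool × List Bool → Bool) (q : Polynomial ℕ),
    ComputesInPolyTime encodePair (fun p w => w = [V p]) ∧
    ∀ x, x ∈ L ↔ ∃ c : List Bool, c.length ≤ q.eval x.length ∧ V (x, c) = true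

/-- `VCSP(Γ)`, for a finite language `Γ`, can be solved to optimality in polynomial time: an
assignment of minimal cost (the list of the labels of all variables) is found. -/
def SolvableInPolyTime {D : Type u} (Γ : Lang D) : Prop :=
  ComputesInPolyTime (Inst.encode (Γ := Γ))
    fun I w => ∃ s : Fin I.nvars → D, w = List.ofFn s ∧ I.IsOptimal s

/-- `VCSP(Γ)`, for a finite language `Γ`, is NP-hard: every problem in NP has a polynomial-time
many-one reduction to the question whether an instance has an assignment of cost at most a given
rational threshold. -/
def NPHard {D : Type u} (Γ : Lang D) : Prop :=
  ∀ L : Set (List Bool), InNP L →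
    ComputesInPolyTime (fun x : List Bool => x) fun x w =>
      ∃ (I : Inst Γ) (q : ℚ), w = encodeWithThreshold (I, q) ∧
        (x ∈ L ↔ ∃ s : Fin I.nvars → D, I.objective s ≤ (q : WithTop ℚ))

def Tractable {D : Type u} (Γ : Lang D) : Prop :=
  ∀ Γ₀ : Lang D, Γ₀ ⊆ Γ → Γ₀.Finite → SolvableInPolyTime Γ₀

def Intractable {D : Type u} (Γ : Lang D) : Prop :=
  ∃ Γ₀ : Lang D, Γ₀ ⊆ Γ ∧ Γ₀.Finite ∧ NPHard Γ₀

/-! ### Polymorphisms, weighted polymorphisms, cores -/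

/-- A `k`-ary operation on `D`. -/
abbrev Op (D : Type u) (k : ℕ) := (Fin k → D) → D

/-- Coordinatewise application of a `k`-ary operation to `k` tuples of length `m`. -/
def Op.onTuples {D : Type u} {k m : ℕ} (f : Op D k) (x : Fin k → Fin m → D) : Fin m → D :=
  fun j => f fun i => x i j

def Op.IsProjection {D : Type u} {k : ℕ} (f : Op D k) : Prop :=
  ∃ i : Fin k, ∀ x : Fin k → D, f x = x i

def IsPolymorphism {D : Type u} {k : ℕ} (φ : WRel D) (f : Op D k) : Prop :=
  ∀ x : Fin k → Fin φ.1 → D, (∀ i, x i ∈ WRel.feas φ) → f.onTuples x ∈ WRel.feas φ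

/-- The `k`-ary part of the clone of polymorphisms of `Γ`. -/
def Pol {D : Type u} (Γ : Lang D) (k : ℕ) : Set (Op D k) :=
  {f | ∀ φ ∈ Γ, IsPolymorphism φ f}

/-- A `k`-ary weighting of a clone whose set of `k`-ary operations is `C` (a finite set, as the
domain is finite in all uses). -/
structure Weighting {D : Type u} {k : ℕ} (C : Set (Op D k)) where
  weight : C → ℚ
  isProjection_of_neg : ∀ f : C, weight f < 0 → Op.IsProjection f.1
  sum_eq_zero : ∑ᶠ f : C, weight f = 0

/-- The operations of positive weight. -/
def Weighting.supp {D : Type u} {k : ℕ} {C : Set (Op D k)} (ω : Weighting C) : Set (Op D k) :=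
  {f | ∃ h : f ∈ C, 0 < ω.weight ⟨f, h⟩}

/-- `ω` is a weighted polymorphism of `φ`. The first conjunct makes all the costs in the sum finite,
so that `untopD 0` is the cost itself. -/
def Weighting.Improves {D : Type u} {k : ℕ} {C : Set (Op D k)} (ω : Weighting C) (φ : WRel D) :
    Prop :=
  (∀ f ∈ C, IsPolymorphism φ f) ∧
  ∀ x : Fin k → Fin φ.1 → D, (∀ i, x i ∈ WRel.feas φ) →
    ∑ᶠ f : C, ω.weight f * (φ.2 (Op.onTuples f.1 x)).untopD 0 ≤ 0

/-- The `k`-ary weighted polymorphisms of `Γ`. -/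
def WPol {D : Type u} (Γ : Lang D) (k : ℕ) : Set (Weighting (Pol Γ k)) :=
  {ω | ∀ φ ∈ Γ, ω.Improves φ}

/-- `Γ` is a core: every operation in the support of a unary weighted polymorphism is bijective. -/
def IsCore {D : Type u} (Γ : Lang D) : Prop :=
  ∀ ω ∈ WPol Γ 1, ∀ f ∈ ω.supp, Function.Bijective fun a : D => f fun _ => a

end VCSP

namespace VCSP

universe u v

variable {A : Type u} {B : Type v}

/-! Let `f` have positive weight in a unary weighted polymorphism `ω`, and let `s` be optimal of
finite cost. Summing the defining inequality over the constraints gives `∑ ω(h) I(h ∘ s) ≤ 0`. The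
weights sum to zero, only the identity can have negative weight, and `I(h ∘ s) ≥ I(s)`; so `I(f ∘ s)
= I(s)` (`Inst.IsOptimal.comp_of_mem_supp`).

Choose `S` minimal among the subsets admitting a map `g : A → S` that preserves optimality for every
instance. A non-surjective `f` in a support over `S` would make `f ∘ g` such a map into a smaller
set, so the restriction to `S` is a core.

Instances over `Γ` and over the restriction differ only in the letters naming weighted relations,
and they have equal optima thanks to `g`. Relabelling letters therefore transfers algorithms and
reductions both ways. -/

/-! ### Replacing the weighted relations of an instance -/

/-- Replacing the weighted relations that occur in a string. -/
def Letter.map {R : Type u} {R' : Type v} (h : R → R') : Letter R → Letter R'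
  | .var => .var
  | .rel r => .rel (h r)
  | .comma => .comma
  | .bit b => .bit b
  | .threshold => .threshold

/-- Replacing the weighted relation of a constraint by one of the same arity. -/
def mapTerm {Γ : Lang A} {Δ : Lang B} (h : Γ → Δ) (hh : ∀ φ, (h φ).1.1 = φ.1.1) {n : ℕ}
    (t : ValuedCSP.Term Γ (Fin n)) : ValuedCSP.Term Δ (Fin n) where
  n := (h ⟨⟨t.n, t.f⟩, t.inΓ⟩).1.1
  f := (h ⟨⟨t.n, t.f⟩, t.inΓ⟩).1.2
  inΓ := (h ⟨⟨t.n, t.f⟩, t.inΓ⟩).2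
  app := t.app ∘ Fin.cast (hh ⟨⟨t.n, t.f⟩, t.inΓ⟩)

/-- Replacing the weighted relations of an instance by weighted relations of the same arity. -/
abbrev Inst.map {Γ : Lang A} {Δ : Lang B} (h : Γ → Δ) (hh : ∀ φ, (h φ).1.1 = φ.1.1)
    (I : Inst Γ) : Inst Δ where
  nvars := I.nvars
  constraints := I.constraints.map (mapTerm h hh)

lemma encodeNat_map {R : Type u} {R' : Type v} (h : R → R') (n : ℕ) :
    (encodeNat n).map (Letter.map h) = encodeNat n := by
  simp only [encodeNat, List.map_map]
  rfl

lemma encodeRat_map {R : Type u} {R' : Type v} (h : R → R') (q : ℚ) :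
    (encodeRat q).map (Letter.map h) = encodeRat q := by
  simp only [encodeRat, List.map_cons, List.map_append, encodeNat_map, Letter.map]

lemma ofFn_comp_cast {α : Type*} {m n : ℕ} (h : m = n) (f : Fin n → α) :
    List.ofFn (f ∘ Fin.cast h) = List.ofFn f := by
  subst h
  rfl

lemma encodeTerm_mapTerm {Γ : Lang A} {Δ : Lang B} (h : Γ → Δ) (hh : ∀ φ, (h φ).1.1 = φ.1.1)
    {n : ℕ} (t : ValuedCSP.Term Γ (Fin n)) :
    encodeTerm (mapTerm h hh t) = (encodeTerm t).map (Letter.map h) := by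
  simp only [encodeTerm, List.map_cons, List.map_flatten, List.map_ofFn]
  congr 2
  refine (ofFn_comp_cast (hh ⟨⟨t.n, t.f⟩, t.inΓ⟩) fun i =>
    (Letter.comma :: encodeNat (t.app i : ℕ) : List (Letter Δ))).trans ?_
  congr 1
  funext i
  simp only [Function.comp_apply, List.map_cons, encodeNat_map, Letter.map]

lemma Inst.encode_map {Γ : Lang A} {Δ : Lang B} (h : Γ → Δ) (hh : ∀ φ, (h φ).1.1 = φ.1.1)
    (I : Inst Γ) : (I.map h hh).encode = I.encode.map (Letter.map h) := by
  simp only [Inst.encode, Inst.map, List.map_append, List.map_replicate, List.map_flatMap,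
    List.flatMap_map, encodeTerm_mapTerm]
  rfl

lemma encodeWithThreshold_map {Γ : Lang A} {Δ : Lang B} (h : Γ → Δ)
    (hh : ∀ φ, (h φ).1.1 = φ.1.1) (I : Inst Γ) (q : ℚ) :
    encodeWithThreshold (I.map h hh, q) = (encodeWithThreshold (I, q)).map (Letter.map h) := by
  simp only [encodeWithThreshold, Inst.encode_map, List.map_append, List.map_cons, encodeRat_map,
    Letter.map]

lemma Inst.objective_eq_sum {Γ : Lang A} (I : Inst Γ) (s : Fin I.nvars → A) :
    I.objective s = (I.constraints.map fun t => t.evalSolution s).sum := by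
  simp [Inst.objective, Inst.toInstance, ValuedCSP.Instance.evalSolution]

lemma Inst.isOptimal_iff {Γ : Lang A} (I : Inst Γ) (s : Fin I.nvars → A) :
    I.IsOptimal s ↔ ∀ t, I.objective s ≤ I.objective t :=
  Iff.rfl

lemma Inst.objective_map {Γ : Lang A} {Δ : Lang B} (h : Γ → Δ) (hh : ∀ φ, (h φ).1.1 = φ.1.1)
    (I : Inst Γ) (s : Fin I.nvars → A) (s' : Fin I.nvars → B)
    (H : ∀ (φ : Γ) (x : Fin φ.1.1 → Fin I.nvars),
      (h φ).1.2 (s' ∘ x ∘ Fin.cast (hh φ)) = φ.1.2 (s ∘ x)) :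
    (I.map h hh).objective s' = I.objective s := by
  rw [Inst.objective_eq_sum, Inst.objective_eq_sum]
  simp only [Inst.map, List.map_map]
  congr 1
  refine List.map_congr_left fun t _ => ?_
  exact H ⟨⟨t.n, t.f⟩, t.inΓ⟩ t.app

/-! ### Unary weighted polymorphisms preserve optimal assignments -/

lemma Inst.objective_comp_lt_top {Γ : Lang A} (I : Inst Γ) {f : Op A 1} (hf : f ∈ Pol Γ 1)
    {s : Fin I.nvars → A} (hs : I.objective s < ⊤) :
    I.objective (fun i => f fun _ => s i) < ⊤ := by
  rw [Inst.objective_eq_sum] at hs ⊢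
  generalize I.constraints = l at hs
  induction l with
  | nil => exact hs
  | cons t l ih =>
    simp only [List.map_cons, List.sum_cons, WithTop.add_lt_top] at hs ⊢
    exact ⟨hf _ t.inΓ (fun _ => s ∘ t.app) fun _ => hs.1, ih hs.2⟩

lemma untopD_add {a b : WithTop ℚ} (ha : a < ⊤) (hb : b < ⊤) :
    (a + b).untopD 0 = a.untopD 0 + b.untopD 0 := by
  lift a to ℚ using ha.ne
  lift b to ℚ using hb.ne
  rfl

lemma Inst.sum_weight_mul_objective_le_zero [Finite A] {Γ : Lang A} (I : Inst Γ)
    {ω : Weighting (Pol Γ 1)} (hω : ω ∈ WPol Γ 1) {s : Fin I.nvars → A}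
    (hs : I.objective s < ⊤) :
    ∑ᶠ f : Pol Γ 1, ω.weight f * (I.objective fun i => f.1 fun _ => s i).untopD 0 ≤ 0 := by
  have hfeas : ∀ f : Pol Γ 1, I.objective (fun i => f.1 fun _ => s i) < ⊤ :=
    fun f => I.objective_comp_lt_top f.2 hs
  simp only [Inst.objective_eq_sum] at hs hfeas ⊢
  generalize I.constraints = l at hs hfeas
  induction l with
  | nil => simp
  | cons t l ih =>
    simp only [List.map_cons, List.sum_cons, WithTop.add_lt_top] at hs hfeas ⊢
    simp only [fun f => untopD_add (hfeas f).1 (hfeas f).2, mul_add]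
    rw [finsum_add_distrib (Set.toFinite _) (Set.toFinite _)]
    exact add_nonpos ((hω _ t.inΓ).2 (fun _ => s ∘ t.app) fun _ => hs.1)
      (ih hs.2 fun f => (hfeas f).2)

lemma Inst.IsOptimal.comp_of_mem_supp [Finite A] {Γ : Lang A} {I : Inst Γ}
    {ω : Weighting (Pol Γ 1)} (hω : ω ∈ WPol Γ 1) {f : Op A 1} (hf : f ∈ ω.supp)
    {s : Fin I.nvars → A} (hs : I.IsOptimal s) : I.IsOptimal fun i => f fun _ => s i := by
  rw [Inst.isOptimal_iff] at hs ⊢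
  -- If the optimum is infinite, every assignment is optimal.
  rcases eq_or_ne (I.objective s) ⊤ with htop | htop
  · intro t
    rw [top_le_iff.1 (htop.symm.trans_le (hs t))]
    exact le_top
  refine fun t => le_trans ?_ (hs t)
  obtain ⟨hfΓ, hpos⟩ := hf
  have := Fintype.ofFinite (Pol Γ 1)
  have hsum := I.sum_weight_mul_objective_le_zero hω htop.lt_top
  have hzero := ω.sum_eq_zero
  rw [finsum_eq_sum_of_fintype] at hsum hzero
  have hfin : ∀ g : Pol Γ 1, I.objective (fun i => g.1 fun _ => s i) ≠ ⊤ :=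
    fun g => (I.objective_comp_lt_top g.2 htop.lt_top).ne
  obtain ⟨a, ha⟩ := WithTop.ne_top_iff_exists.1 htop
  choose b hb using fun g => WithTop.ne_top_iff_exists.1 (hfin g)
  simp only [← hb, WithTop.untopD_coe] at hsum
  have hab : ∀ g, a ≤ b g := fun g => by
    have := hs fun i => g.1 fun _ => s i
    rwa [← ha, ← hb, WithTop.coe_le_coe] at this
  -- A negative weight forces a unary projection, that is, the identity, whose cost difference is
  -- zero.
  have hterm : ∀ g ∈ Finset.univ, 0 ≤ ω.weight g * (b g - a) := by
    intro g _
    rcases lt_or_ge (ω.weight g) 0 with hg | hg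
    · obtain ⟨j, hj⟩ := ω.isProjection_of_neg g hg
      have : b g = a := by
        have := hb g
        simp only [hj] at this
        exact WithTop.coe_injective (this.trans ha.symm)
      simp [this]
    · exact mul_nonneg hg (sub_nonneg.2 (hab g))
  -- Subtracting the constant `a` from all costs is harmless because the weights sum to zero.
  have hle : ∑ g, ω.weight g * (b g - a) ≤ 0 := by
    simpa [mul_sub, Finset.sum_sub_distrib, ← Finset.sum_mul, hzero] using hsum
  have h0 := (Finset.sum_eq_zero_iff_of_nonneg hterm).1
    (le_antisymm hle (Finset.sum_nonneg hterm)) ⟨f, hfΓ⟩ (Finset.mem_univ _)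
  have hba : b ⟨f, hfΓ⟩ = a := by
    rcases mul_eq_zero.1 h0 with h | h
    · exact absurd h hpos.ne'
    · exact sub_eq_zero.1 h
  rw [← ha, ← hba, hb]

/-! ### Restriction to a subset of the domain -/

/-- The restriction of a weighted relation to a subset of the domain. -/
def WRel.restrict (S : Set A) (φ : WRel A) : WRel S :=
  ⟨φ.1, fun x => φ.2 fun i => x i⟩

/-- `g` maps optimal assignments of instances of `VCSP(Γ)` to optimal ones with labels in `S`. -/
def IsOptRetraction (Γ : Lang A) (S : Set A) (g : A → S) : Prop :=
  ∀ (I : Inst Γ) (s : Fin I.nvars → A), I.IsOptimal s → I.IsOptimal fun i => g (s i)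

lemma IsOptRetraction.mono {Γ Δ : Lang A} {S : Set A} {g : A → S} (hg : IsOptRetraction Γ S g)
    (h : Δ ⊆ Γ) : IsOptRetraction Δ S g := by
  intro I s hs
  have key : ∀ t, (I.map (Set.inclusion h) fun _ => rfl).objective t = I.objective t :=
    fun t => I.objective_map _ _ t t fun _ _ => rfl
  have := hg (I.map (Set.inclusion h) fun _ => rfl) s
  simp only [Inst.isOptimal_iff] at this hs ⊢
  intro t
  have := this (fun t => by rw [key, key]; exact hs t) t
  rwa [key, key] at this

lemma IsOptRetraction.isOptimal_of_le [Finite A] {Γ : Lang A} {S : Set A} {g : A → S}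
    (hg : IsOptRetraction Γ S g) (I : Inst Γ) {s : Fin I.nvars → S}
    (hs : ∀ t : Fin I.nvars → S, (I.objective fun i => s i) ≤ I.objective fun i => t i) :
    I.IsOptimal fun i => s i := by
  have : Nonempty (Fin I.nvars → A) := ⟨fun i => s i⟩
  obtain ⟨r, hr⟩ := Finite.exists_min I.objective
  exact fun t => (hs fun i => g (r i)).trans (hg I r hr t)

/-- `g` may raise the cost of a non-optimal assignment, so it is applied to a global minimiser
instead of to the given one. -/
lemma IsOptRetraction.exists_le_iff [Finite A] {Γ : Lang A} {S : Set A} {g : A → S}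
    (hg : IsOptRetraction Γ S g) (I : Inst Γ) (q : WithTop ℚ) :
    (∃ s, I.objective s ≤ q) ↔ ∃ s : Fin I.nvars → S, (I.objective fun i => s i) ≤ q := by
  refine ⟨fun ⟨s, hs⟩ => ?_, fun ⟨s, hs⟩ => ⟨_, hs⟩⟩
  have : Nonempty (Fin I.nvars → A) := ⟨s⟩
  obtain ⟨r, hr⟩ := Finite.exists_min I.objective
  exact ⟨fun i => g (r i), (hg I r hr s).trans hs⟩

lemma WRel.arity_eq_of_restrict_eq {S : Set A} {φ : WRel A} {ψ : WRel S}
    (h : WRel.restrict S φ = ψ) : φ.1 = ψ.1 := by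
  subst h
  rfl

lemma WRel.eval_eq_of_restrict_eq {S : Set A} {φ : WRel A} {ψ : WRel S}
    (h : WRel.restrict S φ = ψ) (x : Fin φ.1 → S) :
    ψ.2 (x ∘ Fin.cast (arity_eq_of_restrict_eq h).symm) = φ.2 fun i => x i := by
  subst h
  rfl

lemma WRel.eval_coe_eq_of_restrict_eq {S : Set A} {φ : WRel A} {ψ : WRel S}
    (h : WRel.restrict S φ = ψ) (x : Fin ψ.1 → S) :
    (φ.2 fun i => x (Fin.cast (arity_eq_of_restrict_eq h) i)) = ψ.2 x := by
  subst h
  rfl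

lemma Inst.objective_map_restrict {S : Set A} {Γ : Lang A} {Δ : Lang S} {h : Γ → Δ}
    (e : ∀ φ : Γ, WRel.restrict S φ.1 = h φ) (I : Inst Γ) (s : Fin I.nvars → S) :
    (I.map h fun φ => (WRel.arity_eq_of_restrict_eq (e φ)).symm).objective s =
      I.objective fun i => s i :=
  I.objective_map _ _ _ _ fun φ x => WRel.eval_eq_of_restrict_eq (e φ) (s ∘ x)

lemma Inst.objective_map_extend {S : Set A} {Γ : Lang A} {Δ : Lang S} {h : Δ → Γ}
    (e : ∀ ψ : Δ, WRel.restrict S (h ψ).1 = ψ) (J : Inst Δ) (s : Fin J.nvars → S) :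
    (J.map h fun ψ => WRel.arity_eq_of_restrict_eq (e ψ)).objective (fun i => (s i : A)) =
      J.objective s :=
  J.objective_map _ _ _ _ fun ψ x => WRel.eval_coe_eq_of_restrict_eq (e ψ) (s ∘ x)

/-! ### Transfer of tractability and intractability -/

/-- Polynomial-time computations are stable under replacing the letters of the input and of the
output. -/
lemma ComputesInPolyTime.of_letter_maps {α β A B A' B' : Type*} {enc : α → List A}
    {Out : α → List B → Prop} {enc' : β → List A'} {Out' : β → List B' → Prop}
    (h : ComputesInPolyTime enc' Out') (p : A → A') (r : B' → B) (m : α → β)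
    (henc : ∀ a, enc' (m a) = (enc a).map p) (hout : ∀ a w, Out' (m a) w → Out a (w.map r)) :
    ComputesInPolyTime enc Out := by
  obtain ⟨tm, inp, out, time, H⟩ := h
  -- The machine and the time bound stay the same, as relabelling preserves the input length.
  refine ⟨tm, inp ∘ p, r ∘ out, time, fun a => ?_⟩
  obtain ⟨w, hw, hw'⟩ := H (m a)
  refine ⟨w, ?_, ?_⟩
  · simpa only [henc, List.map_map, List.length_map] using hw
  · simpa only [List.map_map] using hout a _ hw'

section Transfer

variable {S : Set A} {Γ : Lang A} {Δ : Lang S} {g : A → S}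

/-- A finite part of the restricted language consists of restrictions of a finite part of the
language. -/
lemma exists_extend {Δ₀ : Lang S} (hΔ : Δ₀ ⊆ WRel.restrict S '' Γ) (hfin : Δ₀.Finite) :
    ∃ Γ₀ : Lang A, Γ₀ ⊆ Γ ∧ Γ₀.Finite ∧ ∃ h : Δ₀ → Γ₀, ∀ ψ : Δ₀, WRel.restrict S (h ψ).1 = ψ := by
  -- Distinct relations may have the same restriction; one preimage for each is enough.
  choose c hc using fun ψ : Δ₀ => hΔ ψ.2
  have := hfin.to_subtype
  exact ⟨Set.range c, Set.range_subset_iff.2 fun ψ => (hc ψ).1, Set.finite_range c,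
    fun ψ => ⟨c ψ, Set.mem_range_self ψ⟩, fun ψ => (hc ψ).2⟩

/-- The optimal assignment found over `A` may use labels outside `S`; applying `g` letter by letter
to the output repairs this. -/
lemma SolvableInPolyTime.restrict (hg : IsOptRetraction Γ S g) {h : Δ → Γ}
    (e : ∀ ψ : Δ, WRel.restrict S (h ψ).1 = ψ) (H : SolvableInPolyTime Γ) : SolvableInPolyTime Δ := by
  refine H.of_letter_maps (Letter.map h) g _
    (Inst.encode_map h fun ψ => WRel.arity_eq_of_restrict_eq (e ψ)) ?_
  rintro J _ ⟨s, rfl, hs⟩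
  refine ⟨fun i => g (s i), by rw [List.map_ofFn]; rfl, fun t => ?_⟩
  have := hg _ s hs fun i => (t i : A)
  exact (Inst.objective_map_extend e J _).symm.trans_le
    (this.trans_eq (Inst.objective_map_extend e J t))

variable [Finite A]

lemma SolvableInPolyTime.of_restrict (hg : IsOptRetraction Γ S g) {h : Γ → Δ}
    (e : ∀ φ : Γ, WRel.restrict S φ.1 = h φ) (H : SolvableInPolyTime Δ) : SolvableInPolyTime Γ := by
  refine H.of_letter_maps (Letter.map h) Subtype.val _
    (Inst.encode_map h fun φ => (WRel.arity_eq_of_restrict_eq (e φ)).symm) ?_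
  rintro I _ ⟨s, rfl, hs⟩
  refine ⟨fun i => s i, by rw [List.map_ofFn]; rfl, hg.isOptimal_of_le I fun t => ?_⟩
  rw [← Inst.objective_map_restrict e, ← Inst.objective_map_restrict e]
  exact hs t

lemma NPHard.restrict (hg : IsOptRetraction Γ S g) {h : Γ → Δ}
    (e : ∀ φ : Γ, WRel.restrict S φ.1 = h φ) (H : NPHard Γ) : NPHard Δ := by
  refine fun L hL => (H L hL).of_letter_maps id (Letter.map h) id (fun _ => by simp) ?_
  rintro x _ ⟨I, q, rfl, hx⟩
  refine ⟨_, q, (encodeWithThreshold_map h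
    (fun φ => (WRel.arity_eq_of_restrict_eq (e φ)).symm) I q).symm, ?_⟩
  refine hx.trans ((hg.exists_le_iff I q).trans (exists_congr fun s => ?_))
  rw [Inst.objective_map_restrict e]

lemma NPHard.of_restrict (hg : IsOptRetraction Γ S g) {h : Δ → Γ}
    (e : ∀ ψ : Δ, WRel.restrict S (h ψ).1 = ψ) (H : NPHard Δ) : NPHard Γ := by
  refine fun L hL => (H L hL).of_letter_maps id (Letter.map h) id (fun _ => by simp) ?_
  rintro x _ ⟨J, q, rfl, hx⟩
  refine ⟨_, q, (encodeWithThreshold_map h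
    (fun ψ => WRel.arity_eq_of_restrict_eq (e ψ)) J q).symm, ?_⟩
  rw [hg.exists_le_iff]
  refine hx.trans (exists_congr fun s => ?_)
  rw [Inst.objective_map_extend e]

lemma tractable_iff_restrict (hg : IsOptRetraction Γ S g) :
    Tractable Γ ↔ Tractable (WRel.restrict S '' Γ) := by
  refine ⟨fun H Δ₀ hΔ hfin => ?_, fun H Γ₀ hΓ hfin => ?_⟩
  · obtain ⟨Γ₀, hΓ, hfin', h, e⟩ := exists_extend hΔ hfin
    exact (H Γ₀ hΓ hfin').restrict (hg.mono hΓ) e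
  · exact (H _ (Set.image_mono hΓ) (hfin.image _)).of_restrict (hg.mono hΓ)
      (h := fun φ => ⟨_, Set.mem_image_of_mem _ φ.2⟩) fun _ => rfl

lemma intractable_iff_restrict (hg : IsOptRetraction Γ S g) :
    Intractable Γ ↔ Intractable (WRel.restrict S '' Γ) := by
  refine ⟨fun ⟨Γ₀, hΓ, hfin, H⟩ => ?_, fun ⟨Δ₀, hΔ, hfin, H⟩ => ?_⟩
  · exact ⟨_, Set.image_mono hΓ, hfin.image _, H.restrict (hg.mono hΓ)
      (h := fun φ => ⟨_, Set.mem_image_of_mem _ φ.2⟩) fun _ => rfl⟩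
  · obtain ⟨Γ₀, hΓ, hfin', h, e⟩ := exists_extend hΔ hfin
    exact ⟨Γ₀, hΓ, hfin', H.of_restrict (hg.mono hΓ) e⟩

/-! ### Existence of a core -/

/-- An operation in the support of a unary weighted polymorphism of the restricted language can be
composed with a retraction. -/
lemma IsOptRetraction.comp_of_mem_supp (hg : IsOptRetraction Γ S g)
    {ω : Weighting (Pol (WRel.restrict S '' Γ) 1)} (hω : ω ∈ WPol (WRel.restrict S '' Γ) 1)
    {f : Op S 1} (hf : f ∈ ω.supp) {T : Set A} {g' : A → T}
    (hg' : ∀ a, (g' a : A) = f fun _ => g a) : IsOptRetraction Γ T g' := by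
  intro I s hs
  have e : ∀ φ : Γ, WRel.restrict S φ.1 =
      (⟨_, Set.mem_image_of_mem _ φ.2⟩ : WRel.restrict S '' Γ) := fun _ => rfl
  have hJ : (I.map _ fun φ => (WRel.arity_eq_of_restrict_eq (e φ)).symm).IsOptimal
      fun i => g (s i) := by
    intro t
    exact (Inst.objective_map_restrict e I _).trans_le
      ((hg I s hs _).trans_eq (Inst.objective_map_restrict e I t).symm)
  have hle := hJ.comp_of_mem_supp hω hf fun i => g (s i)
  intro t
  simp only [hg']
  exact ((Inst.objective_map_restrict e I _).symm.trans_le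
    (hle.trans_eq (Inst.objective_map_restrict e I _))).trans (hg I s hs t)

lemma exists_isOptRetraction_isCore [Nonempty A] (Γ : Lang A) :
    ∃ (S : Set A) (g : A → S), IsOptRetraction Γ S g ∧ IsCore (WRel.restrict S '' Γ) := by
  obtain ⟨S, ⟨g, hg⟩, hmin⟩ := Set.Finite.exists_minimal
    (s := {S : Set A | ∃ g : A → S, IsOptRetraction Γ S g}) (Set.toFinite _)
    ⟨Set.univ, fun a => ⟨a, trivial⟩, fun _ _ hs => hs⟩
  refine ⟨S, g, hg, fun ω hω f hf => ?_⟩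
  refine Function.Surjective.bijective_of_finite fun b => ?_
  -- The image of `f` is again a candidate and lies in `S`, so minimality makes `f` surjective,
  -- hence bijective on the finite set `S`.
  have hsub := hmin (y := Set.range fun a : S => (f fun _ => a : A))
    ⟨fun a => ⟨_, Set.mem_range_self (g a)⟩, hg.comp_of_mem_supp hω hf fun _ => rfl⟩
    (Set.range_subset_iff.2 fun a => (f fun _ => a).2)
  obtain ⟨a, ha⟩ := hsub b.2
  exact ⟨a, Subtype.ext ha⟩

end Transfer

end VCSP

theorem mainTheorem2 {D : Type*} [Finite D] (Γ : VCSP.Lang D)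
    (hpos : VCSP.PositiveArity Γ) (hcore : ¬ VCSP.IsCore Γ) :
    ∃ (D' : Set D) (Γ' : VCSP.Lang D'),
      D'.Nonempty ∧ VCSP.PositiveArity Γ' ∧ VCSP.IsCore Γ' ∧
      (VCSP.Tractable Γ ↔ VCSP.Tractable Γ') ∧
      (VCSP.Intractable Γ ↔ VCSP.Intractable Γ') := by
  -- Over an empty domain every language is a core.
  have : Nonempty D := by
    by_contra h
    rw [not_nonempty_iff] at h
    exact hcore fun _ _ _ _ => ⟨fun a => isEmptyElim a, fun a => isEmptyElim a⟩
  obtain ⟨S, g, hg, hS⟩ := VCSP.exists_isOptRetraction_isCore Γ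
  refine ⟨S, VCSP.WRel.restrict S '' Γ, ⟨_, (g (Classical.arbitrary D)).2⟩, ?_, hS,
    VCSP.tractable_iff_restrict hg, VCSP.intractable_iff_restrict hg⟩
  rintro _ ⟨φ, hφ, rfl⟩
  exact hpos φ hφ
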